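/- Let $k$ be a field, let $R=k[x_1,\dots,x_n]$ with its standard grading, and let $I\subsetneq R$ be a monomial ideal (an ideal generated by monomials) of height $c$. For $i\ge 0$ let $\beta_i(R/I)$ be the $i$-th Betti number of the graded $R$-module $R/I$, i.e. the rank of $F_i$ in a minimal graded free resolution $\cdots\to F_2\to F_1\to F_0\to R/I\to 0$ over $R$. Then $$\beta_i(R/I)\ \ge\ \binom{c}{i}\qquad\text{for all } i\ge 0,$$ where $\binom{c}{i}=0$ for $i>c$. In other words, the Buchsbaum–Eisenbud–Horrocks conjecture holds for the modules $R/I$ with $I$ a proper monomial ideal. -/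

import Mathlib

open MvPolynomial

/-- A monomial ideal of `k[x₁, …, xₙ]`: an ideal generated by monomials. -/
def IsMonomialIdeal {k : Type*} [Field k] {n : ℕ} (I : Ideal (MvPolynomial (Fin n) k)) : Prop :=
  ∃ S : Set (Fin n →₀ ℕ), I = Ideal.span ((fun s => monomial s (1 : k)) '' S)

/-- The standard grading of `k[x₁, …, xₙ]` by total degree, indexed by `ℤ`
(the pieces of negative degree are zero). -/
noncomputable def polyGrading (k : Type*) [Field k] (n : ℕ) : ℤ → Submodule k (MvPolynomial (Fin n) k)
  | Int.ofNat d => homogeneousSubmodule (Fin n) k d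
  | Int.negSucc _ => ⊥

/-- The grading of `R ⧸ I` induced by the standard grading of `R = k[x₁, …, xₙ]`. -/
noncomputable def quotientGrading {k : Type*} [Field k] {n : ℕ} (I : Ideal (MvPolynomial (Fin n) k)) (e : ℤ) :
    Submodule k (MvPolynomial (Fin n) k ⧸ I) :=
  (polyGrading k n e).map (Ideal.Quotient.mkₐ k I).toLinearMap

/-- A graded free resolution `⋯ → F₂ → F₁ → F₀ → M → 0` of a graded module `M` over
`R = k[x₁, …, xₙ]`, with finitely generated free modules `Fᵢ = ⨁ⱼ R(-deg i j)` and all maps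
homogeneous of degree `0`. The grading of `M` is given by its pieces `ℳ e`, `e : ℤ`. -/
structure GradedFreeResolution {k : Type*} [Field k] {n : ℕ} (M : Type*) [AddCommGroup M]
    [Module k M] [Module (MvPolynomial (Fin n) k) M] (ℳ : ℤ → Submodule k M) where
  /-- the rank of `Fᵢ` -/
  rank : ℕ → ℕ
  /-- the degrees of the standard basis vectors of `Fᵢ` -/
  deg : (i : ℕ) → Fin (rank i) → ℤ
  /-- the map `F₀ → M` -/
  aug : (Fin (rank 0) → MvPolynomial (Fin n) k) →ₗ[MvPolynomial (Fin n) k] M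
  /-- the map `Fᵢ₊₁ → Fᵢ` -/
  d : (i : ℕ) → (Fin (rank (i + 1)) → MvPolynomial (Fin n) k) →ₗ[MvPolynomial (Fin n) k]
    (Fin (rank i) → MvPolynomial (Fin n) k)
  aug_surjective : Function.Surjective aug
  exact_zero : Function.Exact (d 0) aug
  exact_succ : ∀ i, Function.Exact (d (i + 1)) (d i)
  aug_homogeneous : ∀ j, aug (Pi.single j 1) ∈ ℳ (deg 0 j)
  d_homogeneous : ∀ i j l, d i (Pi.single j 1) l ∈ polyGrading k n (deg (i + 1) j - deg i l)

/-- A graded free resolution is minimal if at each step the free module has the minimal number of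
generators: `rank F₀` is the minimal number of generators of `M`, and `rank Fᵢ₊₁` is the minimal
number of generators of the kernel of the map out of `Fᵢ`. -/
def GradedFreeResolution.IsMinimal {k : Type*} [Field k] {n : ℕ} {M : Type*} [AddCommGroup M]
    [Module k M] [Module (MvPolynomial (Fin n) k) M] {ℳ : ℤ → Submodule k M}
    (F : GradedFreeResolution (n := n) M ℳ) : Prop :=
  F.rank 0 = (⊤ : Submodule (MvPolynomial (Fin n) k) M).spanFinrank ∧
  F.rank 1 = (LinearMap.ker F.aug).spanFinrank ∧
  ∀ i, F.rank (i + 2) = (LinearMap.ker (F.d i)).spanFinrank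

/-- The Betti number `βᵢ(M)` of a finitely generated graded module `M`: the rank of `Fᵢ` in a
minimal graded free resolution of `M`. All minimal graded free resolutions give the same rank; the
infimum picks this common value (and would be `0` if there were no minimal resolution). -/
noncomputable def bettiNumber {k : Type*} [Field k] (n : ℕ) (M : Type*) [AddCommGroup M]
    [Module k M] [Module (MvPolynomial (Fin n) k) M] (ℳ : ℤ → Submodule k M) (i : ℕ) : ℕ :=
  sInf {b : ℕ | ∃ F : GradedFreeResolution (n := n) M ℳ, F.IsMinimal ∧ F.rank i = b}

/-!
The bound holds for every resolution of `R / I` by finitely generated free modules, minimal or not.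

Choose a set `P` of variables, minimal with respect to inclusion, such that `I ⊆ (x_P)`. By Krull's
height theorem `P` has at least `c` elements. Invert the variables outside `P` in `R / I`. For each
`A ⊆ P` with `i` elements, the image of `k[x_A]` in this localization is a nonzero artinian ring, by
minimality of `P`, and so has a socle element that is the class of a monomial. Multiplied by
variables outside `P` this gives a monomial `m_A`, free of the variables in `P \ A`, such that
`x_j m_A ∈ I` for `j ∈ A` (`exists_socle_monomial`). Then `m_A e_A` is a cycle of degree `i` in the
Koszul complex `K(x_P; R / I)`. In a boundary the coefficient of `e_A` is a combination of the `x_j`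
with `j ∈ P \ A`, so no monomial multiple of `m_A` by variables outside `P` can appear in it modulo `I`:
the cycles `m_A e_A` are independent modulo boundaries over `R / (x_P)`, which is the polynomial
ring in the variables outside `P`.

Since the Koszul complex on variables is acyclic on free modules
(`exists_mem_koszulChains_koszulDiff_eq`), a zig-zag through the double complex `K(x_P; F)` embeds
`Hᵢ(K(x_P; R / I))` into a quotient of `Fᵢ / (x_P) Fᵢ` (`exists_lift_koszul_cycles`). Lifting the
classes of the `m_A e_A` gives `(#P choose i)` linearly independent vectors in the free module
`Fᵢ / (x_P) Fᵢ` over `R / (x_P)`, whence `(c choose i) ≤ (#P choose i) ≤ rank Fᵢ`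
(`choose_card_le_rank`).

As the Betti number is an infimum over minimal graded free resolutions, one has to exist
(`IsMonomialIdeal.exists_isMinimal`). It is built from iterated syzygies; the graded Nakayama lemma
`homogeneouslyGenerated_spanFinrank` provides minimal homogeneous generators at each step.
-/

/-! ### The Koszul complex -/

section Koszul

variable {ι : Type*} [LinearOrder ι] {R : Type*} [CommRing R] {M N : Type*} [AddCommGroup M]
  [Module R M] [AddCommGroup N] [Module R N]

/-- The sign `(-1) ^ #{b ∈ B | b < j}` that the exterior algebra attaches to contracting or
multiplying by the `j`-th basis vector next to `e_B`. -/
def koszulSign (R : Type*) [CommRing R] (j : ι) (B : Finset ι) : R :=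
  (-1) ^ (B.filter (· < j)).card

lemma koszulSign_mul_self (j : ι) (B : Finset ι) :
    koszulSign R j B * koszulSign R j B = 1 := by
  rw [koszulSign, ← mul_pow]; simp

lemma koszulSign_insert_self (j : ι) (B : Finset ι) :
    koszulSign R j (insert j B) = koszulSign R j B := by
  rw [koszulSign, koszulSign, Finset.filter_insert, if_neg (lt_irrefl j)]

lemma koszulSign_insert {i j : ι} {B : Finset ι} (hj : j ∉ B) :
    koszulSign R i (insert j B) = (if j < i then -1 else 1) * koszulSign R i B := by
  rw [koszulSign, koszulSign, Finset.filter_insert]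
  split_ifs with h
  · rw [Finset.card_insert_of_notMem (by simp [hj]), pow_succ]; ring
  · rw [one_mul]

lemma koszulSign_swap {i j : ι} {B : Finset ι} (hij : i ≠ j) (hi : i ∉ B) (hj : j ∉ B) :
    koszulSign R i B * koszulSign R j (insert i B) =
      -(koszulSign R j B * koszulSign R i (insert j B)) := by
  rw [koszulSign_insert hi, koszulSign_insert hj]
  rcases lt_or_gt_of_ne hij with h | h
  · rw [if_pos h, if_neg h.not_gt]; ring
  · rw [if_pos h, if_neg h.not_gt]; ring

/-- Contraction with the `j`-th dual basis vector on `⋀(⨁ R eⱼ) ⊗ M`. A chain is written as the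
family of its coefficients at the `e_B`, that is, as a function `Finset ι → M`. -/
def contract (R : Type*) [CommRing R] [Module R M] (j : ι) :
    (Finset ι → M) →ₗ[R] (Finset ι → M) where
  toFun f B := if j ∈ B then 0 else koszulSign R j B • f (insert j B)
  map_add' f g := by
    ext B; by_cases h : j ∈ B <;> simp [h]
  map_smul' r f := by
    ext B; by_cases h : j ∈ B <;> simp [h, smul_comm r]

/-- Exterior multiplication by the `j`-th basis vector. -/
def wedge (R : Type*) [CommRing R] [Module R M] (j : ι) :
    (Finset ι → M) →ₗ[R] (Finset ι → M) where
  toFun f B := if j ∈ B then koszulSign R j B • f (B.erase j) else 0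
  map_add' f g := by
    ext B; by_cases h : j ∈ B <;> simp [h]
  map_smul' r f := by
    ext B; by_cases h : j ∈ B <;> simp [h, smul_comm r]

lemma contract_apply (j : ι) (f : Finset ι → M) (B : Finset ι) :
    contract R j f B = if j ∈ B then 0 else koszulSign R j B • f (insert j B) := rfl

lemma wedge_apply (j : ι) (f : Finset ι → M) (B : Finset ι) :
    wedge R j f B = if j ∈ B then koszulSign R j B • f (B.erase j) else 0 := rfl

lemma contract_contract_self (j : ι) (f : Finset ι → M) : contract R j (contract R j f) = 0 := by
  ext B
  by_cases h : j ∈ B <;> simp [contract_apply, h]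

lemma contract_anticomm {i j : ι} (hij : i ≠ j) (f : Finset ι → M) :
    contract R i (contract R j f) = -contract R j (contract R i f) := by
  ext B
  by_cases hi : i ∈ B
  · simp [contract_apply, hi]
  by_cases hj : j ∈ B
  · simp [contract_apply, hj]
  simp only [contract_apply, hi, hj, Pi.neg_apply, if_false, Finset.mem_insert, hij, hij.symm,
    or_self, smul_smul]
  rw [koszulSign_swap hij hi hj, neg_smul, Finset.insert_comm]

lemma contract_wedge {i j : ι} (hij : i ≠ j) (f : Finset ι → M) :
    contract R i (wedge R j f) = -wedge R j (contract R i f) := by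
  ext B
  by_cases hi : i ∈ B
  · simp [contract_apply, wedge_apply, hi, hij]
  by_cases hj : j ∈ B
  · obtain ⟨C, hC, rfl⟩ : ∃ C, j ∉ C ∧ insert j C = B :=
      ⟨B.erase j, Finset.notMem_erase _ _, Finset.insert_erase hj⟩
    have hiC : i ∉ C := fun h => hi (Finset.mem_insert_of_mem h)
    have e : (insert i (insert j C)).erase j = insert i C := by
      rw [Finset.insert_comm, Finset.erase_insert]
      simp [hij.symm, hC]
    simp only [contract_apply, wedge_apply, hi, Pi.neg_apply, if_false, Finset.mem_insert,
      true_or, or_true, if_true, e, Finset.erase_insert hC, hiC, smul_smul]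
    rw [← neg_smul]
    congr 1
    rw [Finset.insert_comm, koszulSign_insert_self, koszulSign_insert_self]
    have h1 := koszulSign_swap (R := R) hij hiC hC
    have h2 := koszulSign_mul_self (R := R) i C
    have h3 := koszulSign_mul_self (R := R) i (insert j C)
    linear_combination
      koszulSign R i (insert j C) * koszulSign R i C * h1
        - koszulSign R i (insert j C) * koszulSign R j (insert i C) * h2
        - koszulSign R i C * koszulSign R j C * h3
  · simp [contract_apply, wedge_apply, hi, hj, hij.symm]

lemma contract_wedge_self_add (j : ι) (f : Finset ι → M) :
    contract R j (wedge R j f) + wedge R j (contract R j f) = f := by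
  ext B
  by_cases h : j ∈ B
  · have := koszulSign_insert_self (R := R) j (B.erase j)
    rw [Finset.insert_erase h] at this
    simp [contract_apply, wedge_apply, h, smul_smul, Finset.insert_erase h, ← this,
      koszulSign_mul_self]
  · simp [contract_apply, wedge_apply, h, smul_smul, koszulSign_insert_self,
      koszulSign_mul_self]

/-- The differential of the Koszul complex of the elements `x j`, `j ∈ P`, with coefficients
in `M`. -/
def koszulDiff (x : ι → R) (P : Finset ι) : (Finset ι → M) →ₗ[R] (Finset ι → M) :=
  ∑ j ∈ P, x j • contract R j

lemma koszulDiff_apply (x : ι → R) (P : Finset ι) (f : Finset ι → M) (B : Finset ι) :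
    koszulDiff x P f B = ∑ j ∈ P, x j • contract R j f B := by
  simp [koszulDiff, LinearMap.sum_apply, Finset.sum_apply]

lemma koszulDiff_insert (x : ι → R) {a : ι} {P : Finset ι} (ha : a ∉ P) (f : Finset ι → M) :
    koszulDiff x (insert a P) f = x a • contract R a f + koszulDiff x P f := by
  simp [koszulDiff, Finset.sum_insert ha]

lemma contract_koszulDiff (x : ι → R) {a : ι} {P : Finset ι} (ha : a ∉ P) (f : Finset ι → M) :
    contract R a (koszulDiff x P f) = -koszulDiff x P (contract R a f) := by
  simp only [koszulDiff, LinearMap.sum_apply, LinearMap.smul_apply, map_sum, map_smul,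
    ← Finset.sum_neg_distrib]
  refine Finset.sum_congr rfl fun j hj => ?_
  rw [contract_anticomm (ne_of_mem_of_not_mem hj ha).symm, smul_neg]

lemma koszulDiff_wedge (x : ι → R) {a : ι} {P : Finset ι} (ha : a ∉ P) (f : Finset ι → M) :
    koszulDiff x P (wedge R a f) = -wedge R a (koszulDiff x P f) := by
  simp only [koszulDiff, LinearMap.sum_apply, LinearMap.smul_apply, map_sum, map_smul,
    ← Finset.sum_neg_distrib]
  refine Finset.sum_congr rfl fun j hj => ?_
  rw [contract_wedge (ne_of_mem_of_not_mem hj ha), smul_neg]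

lemma koszulDiff_koszulDiff (x : ι → R) (P : Finset ι) (f : Finset ι → M) :
    koszulDiff x P (koszulDiff x P f) = 0 := by
  induction P using Finset.induction_on generalizing f with
  | empty => simp [koszulDiff]
  | insert a P ha ih =>
    simp only [koszulDiff_insert x ha, map_add, map_smul, contract_contract_self, smul_zero,
      zero_add, contract_koszulDiff x ha, ih, smul_neg, add_zero]
    simp

lemma koszulDiff_comp (φ : M →ₗ[R] N) (x : ι → R) (P : Finset ι) (f : Finset ι → M)
    (B : Finset ι) :
    koszulDiff x P (fun C => φ (f C)) B = φ (koszulDiff x P f B) := by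
  simp only [koszulDiff_apply, map_sum, map_smul, contract_apply]
  refine Finset.sum_congr rfl fun j _ => ?_
  split_ifs <;> simp

/-- The chains of degree `m` of the Koszul complex on the variables in `P`. -/
def koszulChains (R M : Type*) [CommRing R] [AddCommGroup M] [Module R M] (P : Finset ι) (m : ℕ) :
    Submodule R (Finset ι → M) where
  carrier := {f | ∀ B, ¬(B ⊆ P ∧ B.card = m) → f B = 0}
  add_mem' hf hg B hB := by simp [hf B hB, hg B hB]
  zero_mem' B _ := rfl
  smul_mem' r f hf B hB := by simp [hf B hB]

lemma koszulDiff_mem_koszulChains (x : ι → R) {P : Finset ι} {m : ℕ} {f : Finset ι → M}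
    (hf : f ∈ koszulChains R M P (m + 1)) : koszulDiff x P f ∈ koszulChains R M P m := by
  intro B hB
  rw [koszulDiff_apply]
  refine Finset.sum_eq_zero fun j hj => ?_
  rw [contract_apply]
  split_ifs with h
  · simp
  · rw [hf, smul_zero, smul_zero]
    rintro ⟨h1, h2⟩
    rw [Finset.card_insert_of_notMem h] at h2
    exact hB ⟨(Finset.subset_insert _ _).trans h1, by omega⟩

lemma koszulDiff_eq_zero_of_mem_koszulChains_zero (x : ι → R) {P : Finset ι} {f : Finset ι → M}
    (hf : f ∈ koszulChains R M P 0) : koszulDiff x P f = 0 := by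
  ext B
  rw [koszulDiff_apply]
  refine Finset.sum_eq_zero fun j _ => ?_
  rw [contract_apply]
  split_ifs with h
  · simp
  · rw [hf, smul_zero, smul_zero]
    rintro ⟨-, h2⟩
    simp at h2

end Koszul

section Exactness

variable {ι : Type*} {k : Type*} [Field k]

lemma mem_span_X_of_X_mul_mem {P : Finset ι} {a : ι} (ha : a ∉ P) {f : MvPolynomial ι k}
    (h : X a * f ∈ Ideal.span ((X : ι → MvPolynomial ι k) '' (P : Set ι))) :
    f ∈ Ideal.span ((X : ι → MvPolynomial ι k) '' (P : Set ι)) := by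
  rw [mem_ideal_span_X_image] at h ⊢
  intro m hm
  obtain ⟨j, hj, hjm⟩ := h (Finsupp.single a 1 + m) (by
    rw [mem_support_iff, coeff_X_mul]; exact mem_support_iff.1 hm)
  refine ⟨j, hj, ?_⟩
  have : a ≠ j := fun e => ha (by simpa [e] using hj)
  simpa [Finsupp.single_apply, this] using hjm

variable [LinearOrder ι]

lemma koszulDiff_empty_mem_span (P : Finset ι) (f : Finset ι → MvPolynomial ι k) :
    koszulDiff (R := MvPolynomial ι k) X P f ∅ ∈
      Ideal.span ((X : ι → MvPolynomial ι k) '' (P : Set ι)) := by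
  rw [koszulDiff_apply]
  exact Ideal.sum_mem _ fun j hj =>
    Ideal.mul_mem_right _ _ (Ideal.subset_span ⟨j, hj, rfl⟩)

/-- The Koszul complex on a set of variables of a polynomial ring is acyclic, by induction on the
set of variables: a cycle is split into its parts without and with the new basis vector. -/
theorem exists_koszulDiff_eq (P : Finset ι) (f : Finset ι → MvPolynomial ι k)
    (hf : ∀ B, ¬B ⊆ P → f B = 0) (hd : koszulDiff (R := MvPolynomial ι k) X P f = 0)
    (h0 : f ∅ ∈ Ideal.span ((X : ι → MvPolynomial ι k) '' (P : Set ι))) :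
    ∃ g, (∀ B, ¬B ⊆ P → g B = 0) ∧ koszulDiff (R := MvPolynomial ι k) X P g = f := by
  induction P using Finset.induction_on generalizing f with
  | empty =>
    refine ⟨0, fun _ _ => rfl, ?_⟩
    ext1 B
    by_cases hB : B = ∅
    · simp only [Finset.coe_empty, Set.image_empty, Ideal.span_empty, Ideal.mem_bot] at h0
      rw [hB, h0, map_zero, Pi.zero_apply]
    · rw [hf B (by simpa using hB), map_zero, Pi.zero_apply]
  | insert a P ha ih =>
    have hsub : ∀ {B : Finset ι}, a ∉ B → B ⊆ insert a P → B ⊆ P := fun {B} h1 h2 =>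
      (Finset.subset_insert_iff_of_notMem h1).1 h2
    have contract_zero : ∀ g : Finset ι → MvPolynomial ι k, (∀ B, ¬B ⊆ P → g B = 0) →
        contract (MvPolynomial ι k) a g = 0 := by
      intro g hg
      ext1 B
      rw [contract_apply]
      split_ifs
      · rfl
      · rw [hg _ fun h => ha (h (Finset.mem_insert_self _ _)), smul_zero]; rfl
    rw [koszulDiff_insert _ ha] at hd
    -- the part of `f` that involves `e_a` is a cycle for the smaller set of variables
    have hd1 : koszulDiff (R := MvPolynomial ι k) X P (contract (MvPolynomial ι k) a f) = 0 := by
      have := congrArg (contract (MvPolynomial ι k) a) hd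
      rw [map_add, map_smul, contract_contract_self, smul_zero, zero_add, map_zero,
        contract_koszulDiff _ ha, neg_eq_zero] at this
      exact this
    obtain ⟨g, hg, hgd⟩ := ih (contract (MvPolynomial ι k) a f) (by
      intro B hB
      rw [contract_apply]
      split_ifs with h
      · rfl
      · rw [hf, smul_zero]
        exact fun h' => hB (hsub h ((Finset.subset_insert _ _).trans h'))) hd1 (by
      refine mem_span_X_of_X_mul_mem ha ?_
      have := congrFun hd ∅
      rw [Pi.add_apply, Pi.smul_apply, smul_eq_mul, Pi.zero_apply] at this
      rw [eq_neg_of_add_eq_zero_left this]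
      exact neg_mem (koszulDiff_empty_mem_span P f))
    -- subtracting a boundary, the part with `e_a` disappears
    set f' := f + koszulDiff (R := MvPolynomial ι k) X (insert a P)
      (wedge (MvPolynomial ι k) a g) with hf'
    have hθg := contract_zero g hg
    have hθη : contract (MvPolynomial ι k) a (wedge (MvPolynomial ι k) a g) = g := by
      have := contract_wedge_self_add (R := MvPolynomial ι k) a g
      rwa [hθg, map_zero, add_zero] at this
    have hθf' : contract (MvPolynomial ι k) a f' = 0 := by
      rw [hf', koszulDiff_insert _ ha, map_add, map_add, map_smul, contract_contract_self,
        smul_zero, zero_add, contract_koszulDiff _ ha, hθη, hgd, add_neg_cancel]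
    have hdf' : koszulDiff (R := MvPolynomial ι k) X P f' = 0 := by
      have h1 : koszulDiff (R := MvPolynomial ι k) X (insert a P) f' = 0 := by
        rw [hf', map_add, koszulDiff_koszulDiff, add_zero, koszulDiff_insert _ ha, hd]
      rwa [koszulDiff_insert _ ha, hθf', smul_zero, zero_add] at h1
    have hsf' : ∀ B, ¬B ⊆ P → f' B = 0 := by
      intro B hB
      by_cases haB : a ∈ B
      · have := congrFun hθf' (B.erase a)
        rw [contract_apply, if_neg (Finset.notMem_erase _ _), Finset.insert_erase haB,
          Pi.zero_apply] at this
        have h2 := congrArg (koszulSign (MvPolynomial ι k) a (B.erase a) • ·) this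
        simpa [← mul_assoc, koszulSign_mul_self] using h2
      · have hB' : ¬B ⊆ insert a P := fun h => hB (hsub haB h)
        rw [hf', koszulDiff_insert _ ha, koszulDiff_wedge _ ha, hθη, Pi.add_apply, Pi.add_apply,
          hf B hB', Pi.smul_apply, hg B hB, Pi.neg_apply, wedge_apply, if_neg haB]
        simp
    have h0' : f' ∅ ∈
        Ideal.span ((X : ι → MvPolynomial ι k) '' ((insert a P : Finset ι) : Set ι)) :=
      Ideal.add_mem _ h0 (koszulDiff_empty_mem_span _ _)
    rw [Finset.coe_insert, Set.image_insert_eq, Ideal.mem_span_insert] at h0'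
    obtain ⟨r, p, hp, hrp⟩ := h0'
    -- the multiple `r • xₐ` of `e_∅` is a boundary as well
    set u : Finset ι → MvPolynomial ι k := fun B => if B = ∅ then r else 0 with hu
    have husupp : ∀ B, ¬B ⊆ P → u B = 0 := fun B hB => by
      rw [hu]; exact if_neg fun h : B = ∅ => hB (h ▸ Finset.empty_subset P)
    have hcu : ∀ Q : Finset ι, koszulDiff (R := MvPolynomial ι k) X Q u = 0 := fun Q =>
      koszulDiff_eq_zero_of_mem_koszulChains_zero _ fun B hB => if_neg fun h => hB (by simp [h])
    have hθηu : contract (MvPolynomial ι k) a (wedge (MvPolynomial ι k) a u) = u := by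
      have := contract_wedge_self_add (R := MvPolynomial ι k) a u
      rwa [contract_zero u husupp, map_zero, add_zero] at this
    have hdu : koszulDiff (R := MvPolynomial ι k) X (insert a P) (wedge (MvPolynomial ι k) a u) =
        (X a : MvPolynomial ι k) • u := by
      rw [koszulDiff_insert _ ha, hθηu, koszulDiff_wedge _ ha, hcu, map_zero, neg_zero, add_zero]
    obtain ⟨h, hh, hhd⟩ := ih (f' - (X a : MvPolynomial ι k) • u)
      (fun B hB => by rw [Pi.sub_apply, hsf' B hB, Pi.smul_apply, husupp B hB]; simp)
      (by rw [map_sub, map_smul, hdf', hcu]; simp)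
      (by
        have : (f' - (X a : MvPolynomial ι k) • u) ∅ = p := by
          rw [Pi.sub_apply, hrp, Pi.smul_apply, hu]
          simp [mul_comm]
        rwa [this])
    have hwsupp : ∀ w : Finset ι → MvPolynomial ι k, (∀ B, ¬B ⊆ P → w B = 0) →
        ∀ B, ¬B ⊆ insert a P → wedge (MvPolynomial ι k) a w B = 0 := by
      intro w hw B hB
      rw [wedge_apply]
      split_ifs
      · rw [hw, smul_zero]
        exact fun h => hB (by rwa [Finset.subset_insert_iff])
      · rfl
    refine ⟨h + wedge (MvPolynomial ι k) a u - wedge (MvPolynomial ι k) a g, fun B hB => ?_, ?_⟩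
    · rw [Pi.sub_apply, Pi.add_apply, hh B fun h => hB (h.trans (Finset.subset_insert _ _)),
        hwsupp u husupp B hB, hwsupp g hg B hB]
      simp
    · rw [map_sub, map_add, hdu, koszulDiff_insert _ ha h, contract_zero h hh, hhd, hf']
      simp

/-- Acyclicity with coefficients in a free module, degree by degree. In degree `0` the condition
`h0` says that the cycle lies in the image of the augmentation ideal; in positive degree it is
vacuous. -/
theorem exists_mem_koszulChains_koszulDiff_eq {P : Finset ι} {m r : ℕ}
    {f : Finset ι → Fin r → MvPolynomial ι k}
    (hf : f ∈ koszulChains (MvPolynomial ι k) _ P m)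
    (hd : koszulDiff (R := MvPolynomial ι k) X P f = 0)
    (h0 : ∀ l, f ∅ l ∈ Ideal.span ((X : ι → MvPolynomial ι k) '' (P : Set ι))) :
    ∃ g ∈ koszulChains (MvPolynomial ι k) (Fin r → MvPolynomial ι k) P (m + 1),
      koszulDiff (R := MvPolynomial ι k) X P g = f := by
  have key : ∀ l, ∃ g, (∀ B, ¬B ⊆ P → g B = 0) ∧
      koszulDiff (R := MvPolynomial ι k) X P g = fun B => f B l := by
    intro l
    refine exists_koszulDiff_eq P _ (fun B hB => ?_) ?_ (h0 l)
    · rw [hf B fun h => hB h.1]; rfl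
    · ext1 B
      have := koszulDiff_comp
        (LinearMap.proj l : (Fin r → MvPolynomial ι k) →ₗ[MvPolynomial ι k] _) X P f B
      simp only [LinearMap.proj_apply] at this
      rw [this, hd]; rfl
  choose g hg hgd using key
  refine ⟨fun B => if B ⊆ P ∧ B.card = m + 1 then fun l => g l B else 0,
    fun B hB => if_neg hB, ?_⟩
  funext B l
  have := koszulDiff_comp (LinearMap.proj l : (Fin r → MvPolynomial ι k) →ₗ[MvPolynomial ι k] _) X P
    (fun B => if B ⊆ P ∧ B.card = m + 1 then fun l => g l B else 0) B
  simp only [LinearMap.proj_apply] at this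
  rw [← this]
  by_cases hB : B ⊆ P ∧ B.card = m
  · rw [← congrFun (hgd l) B, koszulDiff_apply, koszulDiff_apply]
    refine Finset.sum_congr rfl fun j hj => ?_
    rw [contract_apply, contract_apply]
    split_ifs with h h'
    · rfl
    · rfl
    · exact absurd ⟨Finset.insert_subset hj hB.1,
        by rw [Finset.card_insert_of_notMem h, hB.2]⟩ h'
  · rw [hf B hB, koszulDiff_apply]
    refine Finset.sum_eq_zero fun j hj => ?_
    rw [contract_apply]
    split_ifs with h h'
    · simp
    · rw [Finset.card_insert_of_notMem h] at h'
      exact absurd ⟨(Finset.subset_insert _ _).trans h'.1, by omega⟩ hB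
    · simp

end Exactness

universe u

/-! ### Comparison of a free resolution with the Koszul complex -/

/-- The zig-zag through the double complex `K(x_P; F)` of a free resolution `F` of `M`: Koszul
cycles of degree `i` with coefficients in `M` are lifted to elements of `Fᵢ`, in such a way that a
combination of the lifts that lies in `(x_P) Fᵢ` comes from a combination of the cycles that is a
boundary. This is the embedding of `Hᵢ(K(x_P; M))` into a quotient of `Fᵢ / (x_P) Fᵢ`, stated
without forming homology modules. The induction replaces `M` by its first syzygy module. -/
theorem exists_lift_koszul_cycles {k : Type u} [Field k] {n : ℕ} (P : Finset (Fin n)) {α : Type*}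
    [Fintype α] (i : ℕ) : ∀ {M : Type u} [AddCommGroup M] [Module (MvPolynomial (Fin n) k) M]
    (rk : ℕ → ℕ)
    (aug : (Fin (rk 0) → MvPolynomial (Fin n) k) →ₗ[MvPolynomial (Fin n) k] M)
    (d : (i : ℕ) → (Fin (rk (i + 1)) → MvPolynomial (Fin n) k) →ₗ[MvPolynomial (Fin n) k]
      (Fin (rk i) → MvPolynomial (Fin n) k)) (_ : Function.Surjective aug)
    (_ : Function.Exact (d 0) aug) (_ : ∀ i, Function.Exact (d (i + 1)) (d i))
    (z : α → Finset (Fin n) → M)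
    (_ : ∀ a, z a ∈ koszulChains (MvPolynomial (Fin n) k) M P i)
    (_ : ∀ a, koszulDiff (X : Fin n → MvPolynomial (Fin n) k) P (z a) = 0),
    ∃ v : α → Fin (rk i) → MvPolynomial (Fin n) k, ∀ t : α → MvPolynomial (Fin n) k,
      (∀ l, ∑ a, t a * v a l ∈
        Ideal.span ((X : Fin n → MvPolynomial (Fin n) k) '' (P : Set (Fin n)))) →
      ∃ y ∈ koszulChains (MvPolynomial (Fin n) k) M P (i + 1),
        koszulDiff (X : Fin n → MvPolynomial (Fin n) k) P y = ∑ a, t a • z a := by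
  induction i with
  | zero =>
    intro M _ _ rk aug d haug _ _ z hz _
    choose v hv using fun a => haug (z a ∅)
    refine ⟨v, fun t ht => ?_⟩
    set f : Finset (Fin n) → Fin (rk 0) → MvPolynomial (Fin n) k :=
      fun B => if B = ∅ then ∑ a, t a • v a else 0 with hf
    have hfm : f ∈ koszulChains (MvPolynomial (Fin n) k) _ P 0 := fun B hB =>
      if_neg fun h : B = ∅ => hB (by simp [h])
    obtain ⟨g, hgm, hg⟩ := exists_mem_koszulChains_koszulDiff_eq hfm
      (koszulDiff_eq_zero_of_mem_koszulChains_zero _ hfm) (by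
        intro l
        simpa [hf] using ht l)
    refine ⟨fun B => aug (g B), fun B hB => by dsimp only; rw [hgm B hB, map_zero], ?_⟩
    ext1 B
    rw [koszulDiff_comp, hg, hf, Finset.sum_apply]
    dsimp only
    split_ifs with h
    · simp [h, hv]
    · rw [map_zero]
      refine (Finset.sum_eq_zero fun a _ => ?_).symm
      rw [Pi.smul_apply, hz a B (by simp [h]), smul_zero]
  | succ i ih =>
    intro M _ _ rk aug d haug hex hexs z hz hdz
    have lift : ∀ a, ∃ w ∈ koszulChains (MvPolynomial (Fin n) k)
        (Fin (rk 0) → MvPolynomial (Fin n) k) P (i + 1), ∀ B, aug (w B) = z a B := by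
      intro a
      choose w hw using fun B => haug (z a B)
      refine ⟨fun B => if B ⊆ P ∧ B.card = i + 1 then w B else 0, fun B hB => if_neg hB,
        fun B => ?_⟩
      dsimp only
      split_ifs with h
      · exact hw B
      · rw [map_zero, hz a B h]
    choose w hwm hw using lift
    have hker : ∀ a B, koszulDiff (X : Fin n → MvPolynomial (Fin n) k) P (w a) B ∈
        LinearMap.ker aug := by
      intro a B
      rw [LinearMap.mem_ker, ← koszulDiff_comp]
      simp only [hw]
      rw [hdz]; rfl
    have hd0 : ∀ x, d 0 x ∈ LinearMap.ker aug := fun x => (hex _).2 ⟨x, rfl⟩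
    obtain ⟨v, hv⟩ := ih (M := LinearMap.ker aug) (fun j => rk (j + 1))
      ((d 0).codRestrict _ hd0) (fun j => d (j + 1))
      (by
        rintro ⟨x, hx⟩
        obtain ⟨y, rfl⟩ := (hex x).1 hx
        exact ⟨y, rfl⟩)
      (by
        intro x
        rw [← hexs 0 x, Subtype.ext_iff]; rfl)
      (fun j => hexs (j + 1))
      (fun a B => ⟨_, hker a B⟩)
      (fun a B hB => Subtype.ext (koszulDiff_mem_koszulChains _ (hwm a) B hB))
      (by
        intro a
        ext1 B
        apply Subtype.ext
        rw [← Submodule.subtype_apply, ← koszulDiff_comp]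
        simp only [Submodule.subtype_apply]
        rw [koszulDiff_koszulDiff]; rfl)
    refine ⟨v, fun t ht => ?_⟩
    obtain ⟨y, hym, hy⟩ := hv t ht
    -- `∑ t a • w a - y` is a cycle of the acyclic complex `K(x_P; F₀)`
    have hcm : (∑ a, t a • w a - fun B => (y B : Fin (rk 0) → MvPolynomial (Fin n) k)) ∈
        koszulChains (MvPolynomial (Fin n) k) _ P (i + 1) :=
      Submodule.sub_mem _ (Submodule.sum_mem _ fun a _ => Submodule.smul_mem _ _ (hwm a))
        fun B hB => by rw [hym B hB]; rfl
    obtain ⟨g, hgm, hg⟩ := exists_mem_koszulChains_koszulDiff_eq hcm (by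
      rw [map_sub, sub_eq_zero]
      ext1 B
      have h1 := koszulDiff_comp (LinearMap.ker aug).subtype
        (X : Fin n → MvPolynomial (Fin n) k) P y B
      simp only [Submodule.subtype_apply] at h1
      rw [h1, hy, map_sum]
      simp) (by
      intro l
      rw [hcm ∅ (by simp)]
      exact zero_mem _)
    refine ⟨fun B => aug (g B), fun B hB => by dsimp only; rw [hgm B hB, map_zero], ?_⟩
    ext1 B
    rw [koszulDiff_comp, hg]
    have hyB : aug (y B) = 0 := (y B).2
    simp [hyB, hw]

/-! ### Monomial ideals -/

lemma monomial_mem_of_le {k : Type*} [Field k] {n : ℕ} {I : Ideal (MvPolynomial (Fin n) k)}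
    {s t : Fin n →₀ ℕ} (hst : s ≤ t) (hs : monomial s (1 : k) ∈ I) :
    monomial t (1 : k) ∈ I := by
  obtain ⟨u, rfl⟩ := le_iff_exists_add.1 hst
  rw [add_comm, ← one_mul (1 : k), ← monomial_mul]
  exact I.mul_mem_left _ hs

lemma IsMonomialIdeal.monomial_mem {k : Type*} [Field k] {n : ℕ}
    {I : Ideal (MvPolynomial (Fin n) k)} (hI : IsMonomialIdeal I) {f : MvPolynomial (Fin n) k}
    (hf : f ∈ I) {s : Fin n →₀ ℕ} (hs : coeff s f ≠ 0) : monomial s (1 : k) ∈ I := by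
  obtain ⟨S, rfl⟩ := hI
  obtain ⟨u, hu, hus⟩ := mem_ideal_span_monomial_image.1 hf s (mem_support_iff.2 hs)
  exact monomial_mem_of_le hus (Ideal.subset_span ⟨u, hu, rfl⟩)

lemma monomial_mem_span_X {k : Type*} [Field k] {n : ℕ} {P : Finset (Fin n)} {s : Fin n →₀ ℕ} :
    monomial s (1 : k) ∈ Ideal.span ((X : Fin n → MvPolynomial (Fin n) k) '' (P : Set (Fin n))) ↔
      ∃ j ∈ P, s j ≠ 0 := by
  classical
  rw [mem_ideal_span_X_image]
  simp [support_monomial]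

/-- A monomial ideal of height `c` is contained in an ideal `(x_P)` generated by a set `P` of at
least `c` variables that is minimal in the sense that every `x j`, `j ∈ P`, becomes nilpotent
modulo `I` and the other variables of `P` once the variables outside `P` are inverted. -/
lemma IsMonomialIdeal.exists_minimal_variables {k : Type*} [Field k] {n : ℕ}
    {I : Ideal (MvPolynomial (Fin n) k)} (hI : IsMonomialIdeal I) {c : ℕ}
    (hc : I.height = (c : ℕ∞)) :
    ∃ P : Finset (Fin n), c ≤ P.card ∧
      (∀ s : Fin n →₀ ℕ, monomial s (1 : k) ∈ I → ∃ j ∈ P, s j ≠ 0) ∧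
      ∀ j ∈ P, ∃ s : Fin n →₀ ℕ, monomial s (1 : k) ∈ I ∧ ∀ l ∈ P, l ≠ j → s l = 0 := by
  have hne : I ≠ ⊤ := by
    rintro rfl
    rw [Ideal.height_top] at hc
    exact ENat.top_ne_natCast c hc
  have h0 : ∀ s : Fin n →₀ ℕ, monomial s (1 : k) ∈ I → ∃ j ∈ Finset.univ, s j ≠ 0 := by
    intro s hs
    by_contra! h
    have : s = 0 := by ext j; exact h j (Finset.mem_univ _)
    subst this
    exact hne ((Ideal.eq_top_iff_one _).2 hs)
  obtain ⟨P, -, hP⟩ := exists_minimal_le_of_wellFoundedLT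
    (fun P : Finset (Fin n) => ∀ s : Fin n →₀ ℕ, monomial s (1 : k) ∈ I → ∃ j ∈ P, s j ≠ 0) _ h0
  refine ⟨P, ?_, hP.prop, fun j hj => ?_⟩
  · have hle : I ≤ Ideal.span ((X : Fin n → MvPolynomial (Fin n) k) '' (P : Set (Fin n))) := by
      obtain ⟨S, hS⟩ := id hI
      rw [hS, Ideal.span_le]
      rintro _ ⟨s, hs, rfl⟩
      exact monomial_mem_span_X.2 (hP.prop s (hS ▸ Ideal.subset_span ⟨s, hs, rfl⟩))
    have hne' : Ideal.span ((X : Fin n → MvPolynomial (Fin n) k) '' (P : Set (Fin n))) ≠ ⊤ := by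
      rw [Ne, Ideal.eq_top_iff_one, ← C_1, ← monomial_zero', monomial_mem_span_X]
      simp
    have h1 := (Ideal.height_mono hle).trans (Ideal.height_le_spanFinrank _ hne')
    have h2 := Submodule.spanFinrank_span_le_ncard_of_finite (R := MvPolynomial (Fin n) k)
      ((P.finite_toSet).image (X : Fin n → MvPolynomial (Fin n) k))
    have h3 := Set.ncard_image_le (f := (X : Fin n → MvPolynomial (Fin n) k)) P.finite_toSet
    rw [Set.ncard_coe_finset] at h3
    rw [hc] at h1
    exact (Nat.cast_le.1 h1).trans (h2.trans h3)
  · have := hP.not_prop_of_lt (Finset.erase_ssubset hj)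
    push Not at this
    obtain ⟨s, hs, h⟩ := this
    exact ⟨s, hs, fun l hl hlj => h l (Finset.mem_erase.2 ⟨hlj, hl⟩)⟩

/-- For `A ⊆ P` there is a monomial whose class in `R / I`, after the variables outside `P` are
inverted and those of `P \ A` are removed, is a nonzero socle element. -/
lemma exists_socle_monomial {k : Type*} [Field k] {n : ℕ} {I : Ideal (MvPolynomial (Fin n) k)}
    {P : Finset (Fin n)} (h0 : ∀ s : Fin n →₀ ℕ, monomial s (1 : k) ∈ I → ∃ j ∈ P, s j ≠ 0)
    (h1 : ∀ j ∈ P, ∃ s : Fin n →₀ ℕ, monomial s (1 : k) ∈ I ∧ ∀ l ∈ P, l ≠ j → s l = 0)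
    {A : Finset (Fin n)} (hA : A ⊆ P) :
    ∃ m : Fin n →₀ ℕ, (∀ j ∈ P, j ∉ A → m j = 0) ∧
      (∀ j ∈ A, monomial (Finsupp.single j 1 + m) (1 : k) ∈ I) ∧
      ∀ t : Fin n →₀ ℕ, (∀ j ∈ P, t j = 0) → monomial (t + m) (1 : k) ∉ I := by
  choose! s hs hsl using h1
  -- the exponents supported on `A` whose monomials survive inverting the variables outside `P`
  let D : Set (Fin n →₀ ℕ) := {u | (∀ j, j ∉ A → u j = 0) ∧
    ∀ t : Fin n →₀ ℕ, (∀ j ∈ P, t j = 0) → monomial (t + u) (1 : k) ∉ I}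
  have hDfin : D.Finite := by
    refine (Set.finite_Iic (∑ j ∈ P, s j)).subset fun u hu j => ?_
    by_cases hj : j ∈ A
    · refine le_trans ?_ (Finset.single_le_sum (f := fun j => s j) (fun _ _ => zero_le)
        (hA hj) j)
      by_contra! hlt
      refine hu.2 ((s j).erase j) (fun l hl => ?_) (monomial_mem_of_le ?_ (hs j (hA hj)))
      · by_cases hlj : l = j
        · simp [hlj]
        · rw [Finsupp.erase_ne hlj, hsl j (hA hj) l hl hlj]
      · intro l
        by_cases hlj : l = j
        · subst hlj; simpa using hlt.le
        · simp [Finsupp.erase_ne hlj]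
    · rw [hu.1 j hj]; exact Nat.zero_le _
  have hD0 : (0 : Fin n →₀ ℕ) ∈ D := ⟨fun _ _ => rfl, fun t ht hmem => by
    obtain ⟨j, hj, hne⟩ := h0 _ hmem
    simp [ht j hj] at hne⟩
  obtain ⟨u, hu⟩ := hDfin.exists_maximal ⟨0, hD0⟩
  -- by maximality of `u`, each `x j * x ^ u` is killed by a monomial `t j` outside `P`
  have hstep : ∀ j ∈ A, ∃ t : Fin n →₀ ℕ, (∀ l ∈ P, t l = 0) ∧
      monomial (t + (Finsupp.single j 1 + u)) (1 : k) ∈ I := by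
    intro j hj
    have hlt : u < Finsupp.single j 1 + u := by
      refine lt_of_le_of_ne le_add_self fun h => ?_
      have := DFunLike.congr_fun h j
      simp at this
    have hn := hu.not_prop_of_gt hlt
    by_contra! h
    refine hn ⟨fun l hl => ?_, h⟩
    have : j ≠ l := fun e => hl (e ▸ hj)
    simp [this, hu.prop.1 l hl]
  choose! t ht htm using hstep
  have hT : ∀ j ∈ P, (∑ l ∈ A, t l) j = 0 := fun j hj => by
    rw [Finsupp.finsetSum_apply]
    exact Finset.sum_eq_zero fun l hl => ht l hl j hj
  refine ⟨∑ j ∈ A, t j + u, fun j hj hjA => ?_, fun j hj => ?_, fun v hv => ?_⟩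
  · rw [Finsupp.add_apply, hT j hj, hu.prop.1 j hjA]
  · refine monomial_mem_of_le ?_ (htm j hj)
    rw [← add_assoc, ← add_assoc, add_comm (t j)]
    gcongr
    exact Finset.single_le_sum (f := t) (fun _ _ => zero_le) hj
  · rw [← add_assoc]
    exact hu.prop.2 _ fun j hj => by rw [Finsupp.add_apply, hv j hj, hT j hj]

/-! ### The lower bound -/

/-- The Koszul cycles `m_A e_A`, for the monomials `m_A` of `exists_socle_monomial`, are independent
modulo boundaries over the polynomial ring in the variables outside `P`. The resolution need not be
minimal. -/
theorem choose_card_le_rank {k : Type u} [Field k] {n : ℕ} {I : Ideal (MvPolynomial (Fin n) k)}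
    (hI : IsMonomialIdeal I) {P : Finset (Fin n)}
    (h0 : ∀ s : Fin n →₀ ℕ, monomial s (1 : k) ∈ I → ∃ j ∈ P, s j ≠ 0)
    (h1 : ∀ j ∈ P, ∃ s : Fin n →₀ ℕ, monomial s (1 : k) ∈ I ∧ ∀ l ∈ P, l ≠ j → s l = 0)
    {ℳ : ℤ → Submodule k (MvPolynomial (Fin n) k ⧸ I)}
    (F : GradedFreeResolution (n := n) (MvPolynomial (Fin n) k ⧸ I) ℳ) (i : ℕ) :
    P.card.choose i ≤ F.rank i := by
  have hsub : ∀ A : P.powersetCard i, (A : Finset (Fin n)) ⊆ P := fun A =>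
    (Finset.mem_powersetCard.1 A.2).1
  have hcard : ∀ A : P.powersetCard i, (A : Finset (Fin n)).card = i := fun A =>
    (Finset.mem_powersetCard.1 A.2).2
  choose m hm0 hmI hmt using fun A : P.powersetCard i => exists_socle_monomial h0 h1 (hsub A)
  let z : P.powersetCard i → Finset (Fin n) → MvPolynomial (Fin n) k ⧸ I := fun A B =>
    if B = A then Ideal.Quotient.mk I (monomial (m A) 1) else 0
  obtain ⟨v, hv⟩ := exists_lift_koszul_cycles P i F.rank F.aug F.d F.aug_surjective F.exact_zero
    F.exact_succ z
    (fun A B hB => if_neg fun h : B = A => hB ⟨h ▸ hsub A, h ▸ hcard A⟩)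
    (by
      intro A
      ext1 B
      rw [koszulDiff_apply]
      refine Finset.sum_eq_zero fun j _ => ?_
      rw [contract_apply]
      split_ifs with hj
      · simp
      · by_cases h : insert j B = A
        · have hjA : j ∈ (A : Finset (Fin n)) := h ▸ Finset.mem_insert_self _ _
          have : (X j : MvPolynomial (Fin n) k) • z A (insert j B) = 0 := by
            rw [show z A (insert j B) = Ideal.Quotient.mk I (monomial (m A) 1) from if_pos h,
              ← Ideal.Quotient.mk_eq_mk, ← Submodule.Quotient.mk_smul, smul_eq_mul,
              Ideal.Quotient.mk_eq_mk, Ideal.Quotient.eq_zero_iff_mem, X, monomial_mul, one_mul]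
            exact hmI A j hjA
          rw [smul_comm, this, smul_zero]
        · rw [show z A (insert j B) = 0 from if_neg h, smul_zero, smul_zero])
  set 𝔭 := Ideal.span ((X : Fin n → MvPolynomial (Fin n) k) '' (P : Set (Fin n))) with h𝔭
  have key : ∀ t : P.powersetCard i → MvPolynomial (Fin n) k,
      (∀ l, ∑ A, t A * v A l ∈ 𝔭) → ∀ A, t A ∈ 𝔭 := by
    intro t ht A
    obtain ⟨y, -, hy⟩ := hv t ht
    choose g hg using fun B => Ideal.Quotient.mk_surjective (y B)
    -- the coefficient at `e_A` of the boundary lies in the ideal generated by the `x j`, `j ∉ A`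
    have hA : t A * monomial (m A) 1 - koszulDiff (X : Fin n → MvPolynomial (Fin n) k) P g A ∈
        I := by
      rw [← Ideal.Quotient.eq_zero_iff_mem, map_sub, sub_eq_zero]
      have h2 := koszulDiff_comp I.mkQ (X : Fin n → MvPolynomial (Fin n) k) P g A
      have h3 : (fun C => I.mkQ (g C)) = y := funext hg
      rw [h3, hy] at h2
      refine Eq.trans ?_ h2
      rw [Finset.sum_apply, Finset.sum_eq_single A]
      · rw [Pi.smul_apply, show z A A = Ideal.Quotient.mk I (monomial (m A) 1) from if_pos rfl]
        rfl
      · intro B _ hB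
        rw [Pi.smul_apply, show z B A = 0 from if_neg fun h => hB (Subtype.ext h.symm), smul_zero]
      · simp
    rw [h𝔭, mem_ideal_span_X_image]
    intro s hs
    by_contra! hs0
    refine hmt A s hs0 (hI.monomial_mem hA ?_)
    have hb : coeff (s + m A) (koszulDiff (X : Fin n → MvPolynomial (Fin n) k) P g A) = 0 := by
      rw [koszulDiff_apply, coeff_sum]
      refine Finset.sum_eq_zero fun j hj => ?_
      rw [contract_apply]
      split_ifs with hjA
      · simp
      · rw [smul_eq_mul, coeff_X_mul', if_neg]
        simp [hs0 j hj, hm0 A j hj hjA]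
    rw [coeff_sub, hb, sub_zero, coeff_mul_monomial, mul_one]
    exact mem_support_iff.1 hs
  have hne : 𝔭 ≠ ⊤ := by
    rw [Ne, Ideal.eq_top_iff_one, ← C_1, ← monomial_zero', h𝔭, monomial_mem_span_X]
    simp
  have : Nontrivial (MvPolynomial (Fin n) k ⧸ 𝔭) := Ideal.Quotient.nontrivial_iff.2 hne
  have hle := card_le_of_injective (MvPolynomial (Fin n) k ⧸ 𝔭)
    (Fintype.linearCombination (MvPolynomial (Fin n) k ⧸ 𝔭)
      fun A l => Ideal.Quotient.mk 𝔭 (v A l)) (by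
    rw [injective_iff_map_eq_zero]
    intro t ht
    choose t' ht' using fun A => Ideal.Quotient.mk_surjective (t A)
    ext1 A
    rw [← ht' A, Pi.zero_apply, Ideal.Quotient.eq_zero_iff_mem]
    refine key t' (fun l => ?_) A
    rw [← Ideal.Quotient.eq_zero_iff_mem, map_sum]
    have := congrFun ht l
    simpa [Fintype.linearCombination_apply, ← ht'] using this)
  rwa [Fintype.card_coe, Finset.card_powersetCard, Fintype.card_fin] at hle

/-! ### Homogeneous components of vectors of polynomials -/

section Graded

variable {k : Type*} [Field k] {n : ℕ}

lemma mem_polyGrading {z : ℤ} {p : MvPolynomial (Fin n) k} :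
    p ∈ polyGrading k n z ↔ ∀ s, coeff s p ≠ 0 → (s.degree : ℤ) = z := by
  cases z with
  | ofNat d =>
    change p ∈ homogeneousSubmodule (Fin n) k d ↔ _
    rw [mem_homogeneousSubmodule]
    have hw : ∀ s : Fin n →₀ ℕ, Finsupp.weight 1 s = s.degree := fun s => by
      rw [Finsupp.degree_eq_weight_one]; rfl
    refine ⟨fun h s hs => ?_, fun h s hs => ?_⟩
    · exact congrArg Int.ofNat ((hw s).symm.trans (h hs))
    · exact (hw s).trans (Int.ofNat.inj (h s hs))
  | negSucc d =>
    change p ∈ (⊥ : Submodule k _) ↔ _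
    rw [Submodule.mem_bot]
    refine ⟨fun h s hs => absurd (by rw [h, coeff_zero]) hs, fun h => ?_⟩
    ext s
    rw [coeff_zero]
    by_contra hs
    have := h s hs
    omega

/-- The homogeneous component of a polynomial in a degree `z : ℤ`. -/
noncomputable def gradedPart (z : ℤ) : MvPolynomial (Fin n) k →ₗ[k] MvPolynomial (Fin n) k :=
  if 0 ≤ z then homogeneousComponent z.toNat else 0

lemma coeff_gradedPart (z : ℤ) (p : MvPolynomial (Fin n) k) (s : Fin n →₀ ℕ) :
    coeff s (gradedPart z p) = if (s.degree : ℤ) = z then coeff s p else 0 := by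
  rw [gradedPart]
  split_ifs with h1 h2 h2
  · rw [coeff_homogeneousComponent, if_pos (by omega)]
  · rw [coeff_homogeneousComponent, if_neg (by omega)]
  · omega
  · simp

lemma gradedPart_mem (z : ℤ) (p : MvPolynomial (Fin n) k) :
    gradedPart z p ∈ polyGrading k n z := by
  rw [mem_polyGrading]
  intro s hs
  rw [coeff_gradedPart] at hs
  by_contra h
  exact hs (if_neg h)

lemma gradedPart_mul {d : ℤ} (z : ℤ) (p : MvPolynomial (Fin n) k) {q : MvPolynomial (Fin n) k}
    (hq : q ∈ polyGrading k n d) : gradedPart z (p * q) = gradedPart (z - d) p * q := by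
  ext s
  rw [coeff_gradedPart, coeff_mul, coeff_mul]
  have key : ∀ x ∈ Finset.HasAntidiagonal.antidiagonal s,
      coeff x.1 (gradedPart (z - d) p) * coeff x.2 q =
      if (s.degree : ℤ) = z then coeff x.1 p * coeff x.2 q else 0 := by
    rintro ⟨a, b⟩ hab
    rw [Finset.HasAntidiagonal.mem_antidiagonal] at hab
    subst hab
    dsimp only
    by_cases hb : coeff b q = 0
    · simp [hb]
    · have := mem_polyGrading.1 hq b hb
      rw [coeff_gradedPart, ite_mul, zero_mul]
      refine if_congr ?_ rfl rfl
      rw [map_add]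
      push_cast
      omega
  rw [Finset.sum_congr rfl key]
  split_ifs <;> simp

lemma gradedPart_zero (p : MvPolynomial (Fin n) k) : gradedPart 0 p = C (constantCoeff p) := by
  rw [gradedPart, if_pos le_rfl, Int.toNat_zero, homogeneousComponent_zero]; rfl

/-- The component of degree `z` of an element of `⨁ R(-deg l)`. -/
noncomputable def vecPart {r : ℕ} (deg : Fin r → ℤ) (z : ℤ) (v : Fin r → MvPolynomial (Fin n) k) :
    Fin r → MvPolynomial (Fin n) k :=
  fun l => gradedPart (z - deg l) (v l)

lemma exists_sum_vecPart_eq {r : ℕ} (deg : Fin r → ℤ) (v : Fin r → MvPolynomial (Fin n) k) :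
    ∃ E : Finset ℤ, ∑ z ∈ E, vecPart deg z v = v := by
  classical
  refine ⟨Finset.univ.biUnion fun l => (v l).support.image fun s => (s.degree : ℤ) + deg l, ?_⟩
  ext l s
  rw [Finset.sum_apply, coeff_sum]
  simp only [vecPart, coeff_gradedPart]
  by_cases hs : coeff s (v l) = 0
  · simp [hs]
  · rw [Finset.sum_eq_single ((s.degree : ℤ) + deg l), if_pos (by omega)]
    · intro z _ hz
      exact if_neg (by omega)
    · intro h
      refine absurd (Finset.mem_biUnion.2 ⟨l, Finset.mem_univ _, Finset.mem_image.2
        ⟨s, mem_support_iff.2 hs, rfl⟩⟩) h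

/-- A homogeneous map of degree `0` commutes with taking homogeneous components. -/
lemma vecPart_linearCombination {r m : ℕ} {deg : Fin r → ℤ} {e : Fin m → ℤ}
    {g : Fin m → Fin r → MvPolynomial (Fin n) k}
    (hg : ∀ j l, g j l ∈ polyGrading k n (e j - deg l)) (z : ℤ)
    (a : Fin m → MvPolynomial (Fin n) k) :
    vecPart deg z (Fintype.linearCombination (MvPolynomial (Fin n) k) g a) =
      Fintype.linearCombination (MvPolynomial (Fin n) k) g (vecPart e z a) := by
  ext1 l
  simp only [vecPart, Fintype.linearCombination_apply, Finset.sum_apply, Pi.smul_apply,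
    smul_eq_mul, map_sum]
  refine Finset.sum_congr rfl fun j _ => ?_
  rw [gradedPart_mul _ _ (hg j l)]
  congr 2
  ring_nf

end Graded

/-! ### Existence of minimal graded free resolutions -/

section Minimal

variable {k : Type*} [Field k] {n : ℕ}

/-- The submodule `N` of `⨁ R(-deg l)` is generated by `m` homogeneous elements (the `j`-th one
of degree `e j`). The generators may be zero or repeated. -/
def HomogeneouslyGenerated {r : ℕ} (deg : Fin r → ℤ)
    (N : Submodule (MvPolynomial (Fin n) k) (Fin r → MvPolynomial (Fin n) k)) (m : ℕ) : Prop :=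
  ∃ (e : Fin m → ℤ) (g : Fin m → Fin r → MvPolynomial (Fin n) k),
    (∀ j l, g j l ∈ polyGrading k n (e j - deg l)) ∧
      Submodule.span (MvPolynomial (Fin n) k) (Set.range g) = N

lemma exists_homogeneouslyGenerated {r : ℕ} {deg : Fin r → ℤ}
    {N : Submodule (MvPolynomial (Fin n) k) (Fin r → MvPolynomial (Fin n) k)}
    (hN : ∀ z, ∀ v ∈ N, vecPart deg z v ∈ N) : ∃ m, HomogeneouslyGenerated deg N m := by
  let S : Set (Fin r → MvPolynomial (Fin n) k) :=
    {v | v ∈ N ∧ ∃ z, ∀ l, v l ∈ polyGrading k n (z - deg l)}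
  have hS : Submodule.span (MvPolynomial (Fin n) k) S = N := by
    refine le_antisymm (Submodule.span_le.2 fun v hv => hv.1) fun v hv => ?_
    obtain ⟨E, hE⟩ := exists_sum_vecPart_eq deg v
    rw [← hE]
    exact Submodule.sum_mem _ fun z _ =>
      Submodule.subset_span ⟨hN z v hv, z, fun l => gradedPart_mem _ _⟩
  obtain ⟨s, hsS, hs⟩ := (Submodule.fg_span_iff_fg_span_finset_subset S).1
    (hS ▸ IsNoetherian.noetherian N)
  choose e he using fun j => (hsS (s.equivFin.symm j).2).2
  refine ⟨s.card, e, fun j => s.equivFin.symm j, he, ?_⟩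
  rw [← hS, hs]
  congr 1
  ext v
  refine ⟨?_, fun hv => ⟨s.equivFin ⟨v, hv⟩, by simp⟩⟩
  rintro ⟨j, rfl⟩
  exact (s.equivFin.symm j).2

/-- Relations between the members of a homogeneous generating family of the smallest possible size
have no constant terms: otherwise the homogeneous component of such a relation in a suitable degree
would express one generator through the others. -/
lemma constantCoeff_eq_zero_of_relation {r m : ℕ} {deg : Fin r → ℤ}
    {N : Submodule (MvPolynomial (Fin n) k) (Fin r → MvPolynomial (Fin n) k)}
    (hmin : ∀ m' < m, ¬HomogeneouslyGenerated deg N m') {e : Fin m → ℤ}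
    {g : Fin m → Fin r → MvPolynomial (Fin n) k}
    (hg : ∀ j l, g j l ∈ polyGrading k n (e j - deg l))
    (hN : Submodule.span (MvPolynomial (Fin n) k) (Set.range g) = N)
    {a : Fin m → MvPolynomial (Fin n) k}
    (ha : Fintype.linearCombination (MvPolynomial (Fin n) k) g a = 0) (i : Fin m) :
    constantCoeff (a i) = 0 := by
  by_contra hi
  obtain ⟨m, rfl⟩ : ∃ m', m = m' + 1 :=
    Nat.exists_eq_succ_of_ne_zero (by rintro rfl; exact i.elim0)
  refine hmin m (Nat.lt_succ_self m) ⟨fun j => e (i.succAbove j), fun j => g (i.succAbove j),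
    fun j l => hg _ l, ?_⟩
  set T := Submodule.span (MvPolynomial (Fin n) k) (Set.range fun j => g (i.succAbove j)) with hT
  have hmem : ∀ j, g (i.succAbove j) ∈ T := fun j => Submodule.subset_span ⟨j, rfl⟩
  have h0 := vecPart_linearCombination hg (e i) a
  rw [ha, Fintype.linearCombination_apply, Fin.sum_univ_succAbove _ i] at h0
  have hz : vecPart deg (e i) (0 : Fin r → MvPolynomial (Fin n) k) = 0 := by
    ext1 l; simp [vecPart]
  have hgi : g i ∈ T := by
    have h1 : vecPart e (e i) a i = C (constantCoeff (a i)) := by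
      rw [vecPart, sub_self, gradedPart_zero]
    rw [hz, h1] at h0
    have h2 : (C (constantCoeff (a i)) : MvPolynomial (Fin n) k) • g i ∈ T := by
      rw [eq_neg_of_add_eq_zero_left h0.symm]
      exact T.neg_mem (T.sum_mem fun j _ => T.smul_mem _ (hmem j))
    have h3 := T.smul_mem (C (constantCoeff (a i))⁻¹ : MvPolynomial (Fin n) k) h2
    rwa [smul_smul, ← C_mul, inv_mul_cancel₀ hi, C_1, one_smul] at h3
  rw [← hN]
  refine le_antisymm (Submodule.span_mono ?_) (Submodule.span_le.2 ?_)
  · rintro _ ⟨j, rfl⟩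
    exact ⟨_, rfl⟩
  · rintro _ ⟨j, rfl⟩
    rcases eq_or_ne j i with rfl | hj
    · exact hgi
    · obtain ⟨l, rfl⟩ := Fin.exists_succAbove_eq hj
      exact hmem l

/-- The graded Nakayama lemma in the form needed for minimal resolutions: a graded submodule of a
graded free module has a homogeneous generating family with as few members as any generating set. -/
theorem homogeneouslyGenerated_spanFinrank {r : ℕ} {deg : Fin r → ℤ}
    {N : Submodule (MvPolynomial (Fin n) k) (Fin r → MvPolynomial (Fin n) k)}
    (hN : ∀ z, ∀ v ∈ N, vecPart deg z v ∈ N) :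
    HomogeneouslyGenerated deg N N.spanFinrank := by
  classical
  have hex := exists_homogeneouslyGenerated hN
  obtain ⟨m, hm, hmin⟩ : ∃ m, HomogeneouslyGenerated deg N m ∧
      ∀ m' < m, ¬HomogeneouslyGenerated deg N m' :=
    ⟨Nat.find hex, Nat.find_spec hex, fun _ => Nat.find_min hex⟩
  suffices h : m = N.spanFinrank from h ▸ hm
  obtain ⟨e, g, hg, hgN⟩ := hm
  apply le_antisymm
  · obtain ⟨s, hs, hsN⟩ := (IsNoetherian.noetherian N).exists_span_finset_card_eq_spanFinrank
    rw [← hs]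
    -- express the two generating families through each other
    have h1 : ∀ i, ∃ c : s → MvPolynomial (Fin n) k, ∑ j, c j • (j : Fin r → _) = g i := by
      intro i
      have : g i ∈ Submodule.span (MvPolynomial (Fin n) k)
          (Set.range ((↑) : s → Fin r → MvPolynomial (Fin n) k)) := by
        rw [Subtype.range_coe_subtype, Finset.setOfPred_mem, hsN, ← hgN]
        exact Submodule.subset_span ⟨i, rfl⟩
      exact (Submodule.mem_span_range_iff_exists_fun _).1 this
    have h2 : ∀ j : s, ∃ b : Fin m → MvPolynomial (Fin n) k, ∑ i, b i • g i = j := by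
      intro j
      refine (Submodule.mem_span_range_iff_exists_fun _).1 ?_
      rw [hgN, ← hsN]
      exact Submodule.subset_span j.2
    choose c hc using h1
    choose b hb using h2
    have hrel : ∀ i i',
        constantCoeff ((Matrix.of c * Matrix.of b - 1 : Matrix _ _ _) i i') = 0 := by
      intro i i'
      refine constantCoeff_eq_zero_of_relation hmin hg hgN
        (a := (Matrix.of c * Matrix.of b - 1 : Matrix _ _ _) i) ?_ i'
      simp only [Fintype.linearCombination_apply, Matrix.sub_apply, sub_smul,
        Finset.sum_sub_distrib, Matrix.mul_apply, Matrix.of_apply, Finset.sum_smul]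
      rw [Finset.sum_comm]
      simp only [mul_smul, ← Finset.smul_sum, hb, hc]
      simp [Matrix.one_apply]
    -- a one-sided inverse over the field `k` bounds `m` by the size of the other family
    have hone : (Matrix.of c).map constantCoeff * (Matrix.of b).map constantCoeff =
        (1 : Matrix (Fin m) (Fin m) k) := by
      rw [← Matrix.map_mul]
      ext i i'
      have := hrel i i'
      rw [Matrix.sub_apply, map_sub, sub_eq_zero] at this
      rw [Matrix.map_apply, this, Matrix.one_apply, Matrix.one_apply]
      split_ifs <;> simp
    have h3 := Matrix.rank_mul_le_left ((Matrix.of c).map constantCoeff)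
      ((Matrix.of b).map constantCoeff)
    rw [hone, Matrix.rank_one, Fintype.card_fin] at h3
    simpa using h3.trans (Matrix.rank_le_card_width _)
  · rw [← hgN]
    refine (Submodule.spanFinrank_span_le_ncard_of_finite (Set.finite_range g)).trans ?_
    rw [← Set.image_univ]
    refine (Set.ncard_image_le Set.finite_univ).trans ?_
    simp [Set.ncard_univ]

/-- A graded submodule of a graded free module `⨁ R(-deg l)`. -/
structure GradedSubmodule (k : Type*) [Field k] (n : ℕ) where
  /-- the rank of the ambient free module -/
  rank : ℕ
  /-- the degrees of the standard basis vectors of the ambient free module -/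
  deg : Fin rank → ℤ
  /-- the submodule -/
  carrier : Submodule (MvPolynomial (Fin n) k) (Fin rank → MvPolynomial (Fin n) k)
  vecPart_mem : ∀ z, ∀ v ∈ carrier, vecPart deg z v ∈ carrier

/-- The degrees of the members of a chosen minimal homogeneous generating family. -/
noncomputable def GradedSubmodule.genDeg (S : GradedSubmodule k n) :
    Fin S.carrier.spanFinrank → ℤ :=
  (homogeneouslyGenerated_spanFinrank S.vecPart_mem).choose

/-- A chosen minimal homogeneous generating family. -/
noncomputable def GradedSubmodule.gen (S : GradedSubmodule k n) :
    Fin S.carrier.spanFinrank → Fin S.rank → MvPolynomial (Fin n) k :=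
  (homogeneouslyGenerated_spanFinrank S.vecPart_mem).choose_spec.choose

lemma GradedSubmodule.gen_mem (S : GradedSubmodule k n) (j : Fin S.carrier.spanFinrank)
    (l : Fin S.rank) : S.gen j l ∈ polyGrading k n (S.genDeg j - S.deg l) :=
  (homogeneouslyGenerated_spanFinrank S.vecPart_mem).choose_spec.choose_spec.1 j l

lemma GradedSubmodule.span_gen (S : GradedSubmodule k n) :
    Submodule.span (MvPolynomial (Fin n) k) (Set.range S.gen) = S.carrier :=
  (homogeneouslyGenerated_spanFinrank S.vecPart_mem).choose_spec.choose_spec.2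

/-- The minimal free cover of a graded submodule. -/
noncomputable def GradedSubmodule.cover (S : GradedSubmodule k n) :
    (Fin S.carrier.spanFinrank → MvPolynomial (Fin n) k) →ₗ[MvPolynomial (Fin n) k]
      (Fin S.rank → MvPolynomial (Fin n) k) :=
  Fintype.linearCombination (MvPolynomial (Fin n) k) S.gen

lemma GradedSubmodule.cover_single (S : GradedSubmodule k n) (j : Fin S.carrier.spanFinrank) :
    S.cover (Pi.single j 1) = S.gen j := by
  rw [GradedSubmodule.cover, Fintype.linearCombination_apply_single, one_smul]

lemma GradedSubmodule.range_cover (S : GradedSubmodule k n) :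
    LinearMap.range S.cover = S.carrier := by
  rw [GradedSubmodule.cover, Fintype.range_linearCombination, S.span_gen]

/-- The iterated syzygy modules of a graded submodule. -/
noncomputable def GradedSubmodule.syzygy (S : GradedSubmodule k n) : ℕ → GradedSubmodule k n
  | 0 => S
  | i + 1 =>
    { rank := (S.syzygy i).carrier.spanFinrank
      deg := (S.syzygy i).genDeg
      carrier := LinearMap.ker (S.syzygy i).cover
      vecPart_mem := fun z v hv => by
        rw [LinearMap.mem_ker] at hv ⊢
        rw [GradedSubmodule.cover] at hv ⊢
        rw [← vecPart_linearCombination (S.syzygy i).gen_mem, hv]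
        ext1 l
        simp [vecPart] }

lemma GradedSubmodule.exact_cover (S : GradedSubmodule k n) (i : ℕ) :
    Function.Exact (S.syzygy (i + 1)).cover (S.syzygy i).cover :=
  LinearMap.exact_iff.2 (S.syzygy (i + 1)).range_cover.symm

theorem IsMonomialIdeal.exists_isMinimal {I : Ideal (MvPolynomial (Fin n) k)}
    (hI : IsMonomialIdeal I) (hne : I ≠ ⊤) :
    ∃ F : GradedFreeResolution (n := n) (MvPolynomial (Fin n) k ⧸ I) (quotientGrading I),
      F.IsMinimal := by
  let aug : (Fin 1 → MvPolynomial (Fin n) k) →ₗ[MvPolynomial (Fin n) k]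
    MvPolynomial (Fin n) k ⧸ I := I.mkQ ∘ₗ LinearMap.proj 0
  have haug : ∀ v, v ∈ LinearMap.ker aug ↔ v 0 ∈ I := fun v => by
    simp [aug, Ideal.Quotient.eq_zero_iff_mem]
  let S : GradedSubmodule k n :=
    { rank := 1
      deg := 0
      carrier := LinearMap.ker aug
      vecPart_mem := fun z v hv => by
        rw [haug] at hv ⊢
        obtain ⟨S, rfl⟩ := hI
        rw [mem_ideal_span_monomial_image] at hv ⊢
        intro s hs
        refine hv s ?_
        rw [mem_support_iff] at hs ⊢
        intro h
        rw [vecPart, coeff_gradedPart, h, ite_self] at hs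
        exact hs rfl }
  refine ⟨{ rank := fun i => (S.syzygy i).rank
            deg := fun i => (S.syzygy i).deg
            aug := aug
            d := fun i => (S.syzygy i).cover
            aug_surjective := ?_
            exact_zero := ?_
            exact_succ := S.exact_cover
            aug_homogeneous := ?_
            d_homogeneous := ?_ }, ?_, rfl, fun i => rfl⟩
  · intro x
    obtain ⟨p, rfl⟩ := Ideal.Quotient.mk_surjective x
    exact ⟨fun _ => p, rfl⟩
  · intro x
    have hx : x ∈ LinearMap.ker aug ↔ x ∈ LinearMap.range S.cover := by rw [S.range_cover]
    exact hx
  · intro (j : Fin 1)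
    refine ⟨1, mem_polyGrading.2 fun s hs => ?_, ?_⟩
    · have : s = 0 := by
        by_contra h
        rw [coeff_one, if_neg (Ne.symm h)] at hs
        exact hs rfl
      subst this
      simp; rfl
    · rw [Subsingleton.elim j 0]
      change _ = Ideal.Quotient.mk I ((Pi.single (0 : Fin 1) 1 : Fin 1 → _) 0)
      simp
  · intro i (j : Fin (S.syzygy i).carrier.spanFinrank) l
    have := (S.syzygy i).gen_mem j l
    rw [← GradedSubmodule.cover_single] at this
    exact this
  · change 1 = _
    have h1 : Submodule.span (MvPolynomial (Fin n) k) {(1 : MvPolynomial (Fin n) k ⧸ I)} = ⊤ := by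
      rw [eq_top_iff]
      rintro x -
      obtain ⟨p, rfl⟩ := Ideal.Quotient.mk_surjective x
      exact Submodule.mem_span_singleton.2 ⟨p, by
        change Ideal.Quotient.mk I (p • 1) = _
        rw [smul_eq_mul, mul_one]⟩
    have : Nontrivial (MvPolynomial (Fin n) k ⧸ I) := Ideal.Quotient.nontrivial_iff.2 hne
    rw [← h1, Submodule.spanFinrank_singleton one_ne_zero]

end Minimal

theorem mainTheorem1 {k : Type*} [Field k] {n : ℕ} (I : Ideal (MvPolynomial (Fin n) k))
    (hI : IsMonomialIdeal I) (c : ℕ) (hc : I.height = (c : ℕ∞)) (i : ℕ) :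
    c.choose i ≤ bettiNumber n (MvPolynomial (Fin n) k ⧸ I) (quotientGrading I) i := by
  have hne : I ≠ ⊤ := by
    rintro rfl
    rw [Ideal.height_top] at hc
    exact ENat.top_ne_natCast c hc
  obtain ⟨P, hcP, h0, h1⟩ := hI.exists_minimal_variables hc
  obtain ⟨F, hF⟩ := hI.exists_isMinimal hne
  obtain ⟨G, -, hG⟩ := Nat.sInf_mem (s := {b : ℕ | ∃ F : GradedFreeResolution (n := n)
    (MvPolynomial (Fin n) k ⧸ I) (quotientGrading I), F.IsMinimal ∧ F.rank i = b}) ⟨_, F, hF, rfl⟩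
  rw [bettiNumber, ← hG]
  exact (Nat.choose_le_choose i hcP).trans (choose_card_le_rank hI h0 h1 G i)
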